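/- Let $R\subseteq S$ be an extension of commutative unital rings, and let $[R,S]$ be the set of $R$-subalgebras of $S$, ordered by inclusion. The extension has FCP if every chain in $[R,S]$ is finite, and FIP if $[R,S]$ is finite. It is Prüfer if $R\to T$ is a flat epimorphism of commutative rings for each $T\in[R,S]$, and almost-Prüfer if there is $T\in[R,S]$ with $R\subseteq T$ Prüfer and $T\subseteq S$ integral. Let $\overline R$ be the integral closure of $R$ in $S$ and $\widetilde R$ the Prüfer hull of $R$ in $S$, i.e. the greatest $T\in[R,S]$ such that $R\subseteq T$ is Prüfer. $\mathrm{Supp}$ denotes the support of an $R$-module in $\mathrm{Spec}(R)$; $TT'$ denotes the subalgebra generated by $T$ and $T'$; $|X|$ is the cardinality of $X$. **Theorem 7.6.** Suppose that $R\subseteq S$ has FCP. The following statements are equivalent: 1. $\mathrm{Supp}(\overline R/R)\cap\mathrm{Supp}(S/\overline R)=\emptyset$. 2. The map $[R,S]\to[R,\overline R]\times[\overline R,S]$, $T\mapsto(T\cap\overline R,T\overline R)$, is an order-isomorphism. 3. $R\subseteq S$ is almost-Prüfer. 4. $\mathrm{Supp}(S/\overline R)=\mathrm{Supp}(\widetilde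 R/R)$. 5. The map $[R,\widetilde R]\to[\overline R,S]$, $T\mapsto T\overline R$, is an order-isomorphism. 6. The map $[R,\overline R]\to[\widetilde R,S]$, $T\mapsto T\widetilde R$, is an order-isomorphism. 7. The map $[R,\widetilde R]\times[R,\overline R]\to[R,S]$, $(T,T')\mapsto TT'$, is an order-isomorphism. If one of these conditions holds, then $\mathrm{Supp}(S/\widetilde R)=\mathrm{Supp}(\overline R/R)$. If moreover $R\subseteq S$ has FIP, the former conditions are equivalent to each of the following: 8. $|[R,S]|=|[R,\widetilde R]|\,|[R,\overline R]|$. 9. $|[R,S]|=|[R,\overline R]|\,|[\overline R,S]|$. 10. $|[R,\widetilde R]|=|[\overline R,S]|$. 11. $|[R,\overline R]|=|[\widetilde R,S]|$. -/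

import Mathlib

/-!
Ring extensions `R ⊆ S` of commutative rings are given by an injective `algebraMap R S`.
The ordered set `[R, S]` of all `R`-subalgebras of `S` is `Subalgebra R S`; in it `R` is `⊥`,
`S` is `⊤`, the intersection is `⊓` and the product `T T'` (the subalgebra generated by
`T` and `T'`) is `⊔`. For `T ∈ [R, S]`, the set `[R, T]` is `Set.Iic T` and `[T, S]` is `Set.Ici T`.
The integral closure of `R` in `S` is Mathlib's `integralClosure R S`.
-/

section RingExtensions

variable (R S : Type*) [CommRing R] [CommRing S] [Algebra R S]

/-- The finite chain property: every chain of `R`-subalgebras of `S` is finite. -/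
def HasFCP : Prop :=
  ∀ C : Set (Subalgebra R S), IsChain (· ≤ ·) C → C.Finite

/-- The finitely many intermediate algebras property: `[R, S]` is finite. -/
def HasFIP : Prop :=
  Finite (Subalgebra R S)

/-- `R ⊆ S` is Prüfer: `R → T` is a flat epimorphism of commutative rings
for every intermediate ring `T`. -/
def IsPruferExtension : Prop :=
  ∀ T : Subalgebra R S, Module.Flat R T ∧ Algebra.IsEpi R T

/-- The Prüfer hull of `R` in `S`: the greatest Prüfer subextension, as the supremum in `[R, S]`
of all `T` such that `R ⊆ T` is Prüfer. -/
noncomputable def pruferHull : Subalgebra R S :=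
  sSup {T : Subalgebra R S | IsPruferExtension R T}

theorem pruferHull_eq_of_isGreatest {P : Subalgebra R S}
    (hP : IsGreatest {T : Subalgebra R S | IsPruferExtension R T} P) : pruferHull R S = P :=
  hP.isLUB.sSup_eq

/-- `R ⊆ S` is almost-Prüfer: it factors as a Prüfer extension followed by an integral one. -/
def IsAlmostPruferExtension : Prop :=
  ∃ T : Subalgebra R S, IsPruferExtension R T ∧ Algebra.IsIntegral T S

variable {R S}

/-- `Supp_R (B / A)` for `R`-subalgebras `A ⊆ B` of `S`. -/
def suppQuotient (A B : Subalgebra R S) : Set (PrimeSpectrum R) :=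
  Module.support R
    (Subalgebra.toSubmodule B ⧸
      (Subalgebra.toSubmodule A).submoduleOf (Subalgebra.toSubmodule B))

/-- A map between ordered sets that is an order-isomorphism. -/
def IsOrderIsomorphism {α β : Type*} [LE α] [LE β] (f : α → β) : Prop :=
  ∃ e : α ≃o β, ∀ a, e a = f a

/-- `[R, S] → [R, A] × [A, S]`, `T ↦ (T ∩ A, T A)`. -/
def infSupMap (A : Subalgebra R S) (T : Subalgebra R S) : Set.Iic A × Set.Ici A :=
  (⟨T ⊓ A, Set.mem_Iic.2 inf_le_right⟩, ⟨T ⊔ A, Set.mem_Ici.2 le_sup_right⟩)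

/-- `[R, B] → [A, S]`, `T ↦ T A`. -/
def prodMap (B A : Subalgebra R S) (T : Set.Iic B) : Set.Ici A :=
  ⟨(T : Subalgebra R S) ⊔ A, Set.mem_Ici.2 le_sup_right⟩

/-- `[R, A] × [R, B] → [R, S]`, `(T, T') ↦ T T'`. -/
def prodMap₂ (A B : Subalgebra R S) (p : Set.Iic A × Set.Iic B) : Subalgebra R S :=
  (p.1 : Subalgebra R S) ⊔ (p.2 : Subalgebra R S)

end RingExtensions

/-! ### Elementwise criterion for Prüfer extensions -/

section PruferElements

variable (R : Type*) {S : Type*} [CommRing R] [CommRing S] [Algebra R S]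

/-! Write A for the integral closure, P for the Prüfer hull and c for the conductor of R in A.
Prüfer extensions are detected on elements: s is Prüfer when (R : s)R[s] contains 1. Under FCP this
identifies P as the set of s with (R : s) + c = R (`isGreatest_comaximalSubalgebra`).

Hence there is a local dichotomy, valid without any of the listed conditions: at a prime not
containing c, A agrees with R; at a prime containing c, P agrees with R. Any inclusion of
subalgebras can be checked at primes, so for X ≤ P and Y ≤ A the product XY meets P in X and A in Y.
The product maps are therefore always order embeddings.

Every condition reduces to PA = S. If PA = S, the same dichotomy gives T = (T ∩ P)(T ∩ A) for all T,
hence the isomorphisms and the supports. Conversely, surjectivity of any of the maps forces PA = S.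
For the cardinalities, all the maps are injective beforehand (`infSupMap_injective` covers the
remaining one), so between finite sets equal cardinality gives surjectivity. -/

/-- The ideal `(R : s)` of all `r` in `R` such that `r s` lies in (the image of) `R`. -/
def colonIdeal (s : S) : Ideal R where
  carrier := {r | r • s ∈ (⊥ : Subalgebra R S)}
  add_mem' := fun ha hb => by
    simpa only [Set.mem_ofPred_eq, add_smul] using add_mem ha hb
  zero_mem' := by simp
  smul_mem' := fun c x hx => by
    simpa only [Set.mem_ofPred_eq, smul_eq_mul, mul_smul] using Subalgebra.smul_mem _ hx c

variable {R} in
theorem mem_colonIdeal {s : S} {r : R} :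
    r ∈ colonIdeal R s ↔ r • s ∈ (⊥ : Subalgebra R S) := Iff.rfl

/-- `s` is a Prüfer element over `R` if `(R : s) R[s] = R[s]`. -/
def IsPruferElement (s : S) : Prop :=
  (1 : S) ∈ colonIdeal R s • Subalgebra.toSubmodule (Algebra.adjoin R {s})

/-- (R : s) is the kernel of R → S/R, 1 ↦ s. By flatness it stays the kernel after tensoring with S,
and 1 ⊗ s = s ⊗ 1 dies in S ⊗ S/R because the extension is epi; so 1 lies in (R : s)S. -/
theorem one_mem_colonIdeal_smul_top_of_flat_of_isEpi [Module.Flat R S] [Algebra.IsEpi R S]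
    (s : S) : (1 : S) ∈ colonIdeal R s • (⊤ : Submodule R S) := by
  let N : Submodule R S := Subalgebra.toSubmodule ⊥
  let φ : R →ₗ[R] S ⧸ N := LinearMap.toSpanSingleton R (S ⧸ N) (N.mkQ s)
  have hker : ∀ r, r ∈ LinearMap.ker φ ↔ r ∈ colonIdeal R s := by
    intro r
    rw [LinearMap.mem_ker, LinearMap.toSpanSingleton_apply, ← map_smul, Submodule.mkQ_apply,
      Submodule.Quotient.mk_eq_zero]
    exact Iff.rfl
  have hexact : Function.Exact (LinearMap.ker φ).subtype φ := by
    intro r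
    simp
  have h := Module.Flat.lTensor_exact S hexact
  have h1 : (φ.lTensor S) (1 ⊗ₜ[R] 1) = 0 := by
    have hs : (1 : S) ⊗ₜ[R] s = s ⊗ₜ[R] 1 := (Algebra.isEpi_iff_forall_one_tmul_eq R S).1 ‹_› s
    have hN : N.mkQ 1 = 0 := by
      rw [Submodule.mkQ_apply, Submodule.Quotient.mk_eq_zero]
      exact one_mem (⊥ : Subalgebra R S)
    have := congrArg (N.mkQ.lTensor S) hs
    rw [LinearMap.lTensor_tmul, LinearMap.lTensor_tmul, hN, TensorProduct.tmul_zero] at this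
    rw [LinearMap.lTensor_tmul, LinearMap.toSpanSingleton_apply, one_smul, this]
  obtain ⟨z, hz⟩ := (h _).1 h1
  have key : ∀ z : TensorProduct R S (LinearMap.ker φ),
      TensorProduct.rid R S ((LinearMap.ker φ).subtype.lTensor S z) ∈
        colonIdeal R s • (⊤ : Submodule R S) := by
    intro z
    induction z with
    | zero => simp
    | add x y hx hy => simpa using add_mem hx hy
    | tmul x y =>
      simpa using Submodule.smul_mem_smul ((hker y).1 y.2) (Submodule.mem_top (x := x))
  simpa [hz] using key z

variable {R}

/-- Equational criterion: a single ideal J with JS = S carries all the x i into R, and writing 1 = ∑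
aₛ s with aₛ ∈ J gives x i = ∑ (aₛ x i) s with coefficients in R. -/
theorem flat_of_one_mem_colonIdeal_smul_top (hinj : Function.Injective (algebraMap R S))
    (h : ∀ s : S, (1 : S) ∈ colonIdeal R s • (⊤ : Submodule R S)) : Module.Flat R S := by
  have htop : ∀ I : Ideal R, (1 : S) ∈ I • (⊤ : Submodule R S) → I • (⊤ : Submodule R S) = ⊤ := by
    intro I hI
    rw [Ideal.smul_top_eq_map] at hI ⊢
    rw [Submodule.restrictScalars_mem] at hI
    rw [(Ideal.eq_top_iff_one _).2 hI, Submodule.restrictScalars_top]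
  refine Module.Flat.of_forall_isTrivialRelation fun {l f x} hfx => ?_
  let J : Ideal R := ∏ i, colonIdeal R (x i)
  have hJ : J • (⊤ : Submodule R S) = ⊤ := by
    refine Finset.prod_induction (fun i => colonIdeal R (x i))
      (fun I => I • (⊤ : Submodule R S) = ⊤) ?_ (by rw [Ideal.one_eq_top, Submodule.top_smul])
      fun i _ => htop _ (h (x i))
    intro I I' hI hI'
    rw [← smul_eq_mul, Submodule.smul_assoc, hI', hI]
  have h1 : (1 : S) ∈ J • Submodule.span R (Set.range (fun s : S => s)) := by
    rw [Set.range_id', Submodule.span_univ, hJ]; trivial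
  obtain ⟨a, ha, hsum⟩ := (Submodule.mem_ideal_smul_span_iff_exists_sum J _ _).1 h1
  have hb : ∀ (i : Fin l) (s : S), ∃ b : R, algebraMap R S b = a s • x i := by
    intro i s
    exact Algebra.mem_bot.1 (mem_colonIdeal.1 ((Ideal.prod_le_inf.trans
      (Finset.inf_le (Finset.mem_univ i))) (ha s)))
  choose b hb using hb
  let e := a.support.equivFin
  refine ⟨_, fun i j => b i (e.symm j), fun j => e.symm j, fun i => ?_, fun j => hinj ?_⟩
  · rw [e.symm.sum_comp (fun s : a.support => b i s • (s : S)),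
      Finset.sum_coe_sort a.support (fun s => b i s • s)]
    calc x i = x i * a.sum (fun s c => c • s) := by rw [hsum, mul_one]
      _ = ∑ s ∈ a.support, b i s • s := by
        rw [Finsupp.sum, Finset.mul_sum]
        refine Finset.sum_congr rfl fun s _ => ?_
        rw [Algebra.smul_def (b i s), hb, mul_smul_comm, smul_mul_assoc]
  · rw [map_zero, map_sum]
    calc ∑ i, algebraMap R S (f i * b i (e.symm j))
        = ∑ i, a (e.symm j) • (f i • x i) := by
          refine Finset.sum_congr rfl fun i _ => ?_
          rw [map_mul, hb, ← Algebra.smul_def, smul_comm]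
      _ = 0 := by rw [← Finset.smul_sum, hfx, smul_zero]

/-- For r in (R : s), the scalar rs lies in R and can be moved across the tensor sign. -/
theorem isEpi_of_one_mem_colonIdeal_smul_top
    (h : ∀ s : S, (1 : S) ∈ colonIdeal R s • (⊤ : Submodule R S)) : Algebra.IsEpi R S := by
  refine (Algebra.isEpi_iff_forall_one_tmul_eq R S).2 fun s => ?_
  have key : ∀ x ∈ colonIdeal R s • (⊤ : Submodule R S),
      x ⊗ₜ[R] s = (x * s) ⊗ₜ[R] (1 : S) := by
    intro x hx
    refine Submodule.smul_induction_on hx (fun r hr y _ => ?_) fun x y hx hy => ?_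
    · obtain ⟨b, hb⟩ := Algebra.mem_bot.1 (mem_colonIdeal.1 hr)
      rw [TensorProduct.smul_tmul, ← hb, Algebra.algebraMap_eq_smul_one,
        ← TensorProduct.smul_tmul, smul_mul_assoc, ← mul_smul_comm, ← hb,
        Algebra.algebraMap_eq_smul_one, mul_smul_comm, mul_one]
    · rw [TensorProduct.add_tmul, hx, hy, add_mul, TensorProduct.add_tmul]
  simpa using key 1 (h s)

theorem colonIdeal_coe {T : Subalgebra R S} (t : T) :
    colonIdeal R (t : S) = colonIdeal R t := by
  ext r
  rw [mem_colonIdeal, mem_colonIdeal, Algebra.mem_bot, Algebra.mem_bot]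
  exact exists_congr fun x => ⟨fun h => Subtype.ext h, fun h => congrArg Subtype.val h⟩

theorem isPruferElement_coe_iff {T : Subalgebra R S} (t : T) :
    IsPruferElement R (t : S) ↔ IsPruferElement R t := by
  have hmap : Subalgebra.toSubmodule (Algebra.adjoin R {(t : S)}) =
      (Subalgebra.toSubmodule (Algebra.adjoin R {t})).map T.val.toLinearMap := by
    rw [← Subalgebra.map_toSubmodule, AlgHom.map_adjoin, Set.image_singleton]
    rfl
  rw [IsPruferElement, IsPruferElement, colonIdeal_coe, hmap, ← Submodule.map_smul'']
  constructor
  · rintro ⟨x, hx, hx1⟩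
    rwa [show x = 1 from Subtype.ext hx1] at hx
  · exact fun h => ⟨1, h, rfl⟩

theorem IsPruferElement.one_mem_smul {s : S} (h : IsPruferElement R s) {T : Subalgebra R S}
    (hs : s ∈ T) : (1 : S) ∈ colonIdeal R s • Subalgebra.toSubmodule T :=
  Submodule.smul_mono le_rfl
    (Subalgebra.toSubmodule.monotone (Algebra.adjoin_le (Set.singleton_subset_iff.2 hs))) h

theorem one_mem_colonIdeal_smul_top_iff {T : Subalgebra R S} (t : T) :
    (1 : T) ∈ colonIdeal R t • (⊤ : Submodule R T) ↔
      (1 : S) ∈ colonIdeal R (t : S) • Subalgebra.toSubmodule T := by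
  have hmap : Subalgebra.toSubmodule T = (⊤ : Submodule R T).map T.val.toLinearMap := by
    rw [Submodule.map_top]
    exact (Submodule.range_subtype _).symm
  rw [colonIdeal_coe, hmap, ← Submodule.map_smul'']
  constructor
  · exact fun h => ⟨1, h, rfl⟩
  · rintro ⟨x, hx, hx1⟩
    rwa [show x = 1 from Subtype.ext hx1] at hx

/-- Forwards, only the intermediate ring R[s] is needed; backwards, the relation in R[t] persists in
every T containing t. -/
theorem isPruferExtension_iff (hinj : Function.Injective (algebraMap R S)) :
    IsPruferExtension R S ↔ ∀ s : S, IsPruferElement R s := by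
  constructor
  · intro h s
    obtain ⟨_, _⟩ := h (Algebra.adjoin R {s})
    exact (one_mem_colonIdeal_smul_top_iff ⟨s, Algebra.self_mem_adjoin_singleton R s⟩).1
      (one_mem_colonIdeal_smul_top_of_flat_of_isEpi R _)
  · intro h T
    have h1 (t : T) : (1 : T) ∈ colonIdeal R t • (⊤ : Submodule R T) :=
      (one_mem_colonIdeal_smul_top_iff t).2 ((h t).one_mem_smul t.2)
    exact ⟨flat_of_one_mem_colonIdeal_smul_top
      (fun a b hab => hinj (congrArg Subtype.val hab)) h1,
      isEpi_of_one_mem_colonIdeal_smul_top h1⟩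

theorem isPruferExtension_subalgebra_iff (hinj : Function.Injective (algebraMap R S))
    (T : Subalgebra R S) : IsPruferExtension R T ↔ ∀ t ∈ T, IsPruferElement R t := by
  rw [isPruferExtension_iff fun a b hab => hinj (congrArg Subtype.val hab)]
  exact ⟨fun h t ht => (isPruferElement_coe_iff ⟨t, ht⟩).2 (h _),
    fun h t => (isPruferElement_coe_iff t).1 (h t t.2)⟩

end PruferElements

/-! ### Consequences of FCP: polynomial relations and finiteness -/

section FiniteChains

variable {R S : Type*} [CommRing R] [CommRing S] [Algebra R S]

theorem HasFCP.exists_eq_succ_of_monotone (h : HasFCP R S) {f : ℕ → Subalgebra R S}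
    (hf : Monotone f) : ∃ n, f n = f (n + 1) := by
  by_contra! hne
  exact Set.infinite_range_of_injective
    (strictMono_nat_of_lt_succ fun n => lt_of_le_of_ne (hf n.le_succ) (hne n)).injective
    (h _ hf.isChain_range)

theorem HasFCP.exists_eq_succ_of_antitone (h : HasFCP R S) {f : ℕ → Subalgebra R S}
    (hf : Antitone f) : ∃ n, f n = f (n + 1) := by
  by_contra! hne
  exact Set.infinite_range_of_injective
    (strictAnti_nat_of_succ_lt fun n => lt_of_le_of_ne (hf n.le_succ) (hne n).symm).injective
    (h _ hf.isChain_range)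

theorem HasFCP.wellFoundedGT (h : HasFCP R S) : WellFoundedGT (Subalgebra R S) := by
  rw [WellFoundedGT, isWellFounded_iff, RelEmbedding.wellFounded_iff_isEmpty]
  refine ⟨fun f => ?_⟩
  have hf : StrictMono f := fun a b hab => f.map_rel_iff.2 hab
  obtain ⟨n, hn⟩ := h.exists_eq_succ_of_monotone hf.monotone
  exact (Nat.succ_ne_self n) (hf.injective hn).symm

theorem HasFCP.subalgebra_base (h : HasFCP R S) (B : Subalgebra R S) : HasFCP B S := by
  intro C hC
  have hinj : Function.Injective (Subalgebra.restrictScalars R : Subalgebra B S → _) :=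
    Subalgebra.restrictScalars_injective R
  refine Set.Finite.of_finite_image (h _ ?_) hinj.injOn
  rintro _ ⟨X, hX, rfl⟩ _ ⟨Y, hY, rfl⟩ hne
  exact hC hX hY fun h => hne (congrArg _ h)

-- The descending chain of the R[t^(2^n)] stabilises, so t^(2^n) = g(t^(2^(n+1))) for some g.
variable (R) in
theorem HasFCP.exists_aeval_eq_zero (h : HasFCP R S) (t : S) :
    ∃ f : Polynomial R, Polynomial.aeval t f = 0 ∧ ∃ i, f.coeff i = -1 := by
  obtain ⟨n, hn⟩ := h.exists_eq_succ_of_antitone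
    (f := fun n => Algebra.adjoin R {t ^ 2 ^ n}) (antitone_nat_of_succ_le fun n => by
      refine Algebra.adjoin_le (Set.singleton_subset_iff.2 ?_)
      rw [pow_succ, pow_mul]
      exact pow_mem (Algebra.self_mem_adjoin_singleton R _) 2)
  have hmem : t ^ 2 ^ n ∈ Algebra.adjoin R {t ^ 2 ^ (n + 1)} :=
    hn ▸ Algebra.self_mem_adjoin_singleton R _
  rw [Algebra.adjoin_singleton_eq_range_aeval] at hmem
  obtain ⟨g, hg⟩ := hmem
  -- This is g(X^(2^(n+1))) - X^(2^n); the first term involves only exponents divisible by 2^(n+1),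
  -- so the coefficient at 2^n is -1.
  refine ⟨Polynomial.expand R (2 ^ n) (Polynomial.expand R 2 g - Polynomial.X), ?_, 2 ^ n, ?_⟩
  · rw [Polynomial.expand_aeval, map_sub, Polynomial.expand_aeval, Polynomial.aeval_X, ← pow_mul,
      ← pow_succ, sub_eq_zero]
    exact hg
  · rw [Polynomial.coeff_expand (by positivity), if_pos dvd_rfl, Nat.div_self (by positivity),
      Polynomial.coeff_sub, Polynomial.coeff_X_one, Polynomial.coeff_expand two_pos,
      if_neg (by decide), zero_sub]

open Polynomial in
/-- If `T` is integrally closed over `R`, then the coefficients of any polynomial relation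
of `t ∈ T` lie in `(R : t) R[t]`. -/
theorem algebraMap_coeff_mem_colonIdeal_smul_adjoin (hinj : Function.Injective (algebraMap R S))
    {T : Subalgebra R S} (hT : ∀ x ∈ T, IsIntegral R x → x ∈ (⊥ : Subalgebra R S))
    {t : S} (ht : t ∈ T) (n : ℕ) :
    ∀ f : R[X], f.natDegree < n → aeval t f = 0 → ∀ i, algebraMap R S (f.coeff i) ∈
      colonIdeal R t • Subalgebra.toSubmodule (Algebra.adjoin R {t}) := by
  induction n with
  | zero => intro f hf; omega
  | succ n ih =>
    intro f hf h0
    by_cases hd : f.natDegree = 0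
    · rw [eq_C_of_natDegree_eq_zero hd, aeval_C, ← map_zero (algebraMap R S)] at h0
      rw [eq_C_of_natDegree_eq_zero hd, hinj h0]
      simp
    obtain ⟨d, hd⟩ := Nat.exists_eq_succ_of_ne_zero hd
    -- Leading coefficient times t is integral over R and lies in T, hence equals some b in R.
    have hc : f.leadingCoeff ∈ colonIdeal R t :=
      hT _ (T.smul_mem ht _) (isIntegral_leadingCoeff_smul f t h0)
    obtain ⟨b, hb⟩ := Algebra.mem_bot.1 (mem_colonIdeal.1 hc)
    have hK : ∀ r ∈ colonIdeal R t, ∀ x ∈ Algebra.adjoin R {t}, r • x ∈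
        colonIdeal R t • Subalgebra.toSubmodule (Algebra.adjoin R {t}) :=
      fun r hr x hx => Submodule.smul_mem_smul hr hx
    have hf1 : f = f.eraseLead + C f.leadingCoeff * X ^ (d + 1) := by
      rw [← Nat.succ_eq_add_one, ← hd]
      exact (eraseLead_add_C_mul_X_pow f).symm
    have hbK : algebraMap R S b ∈
        colonIdeal R t • Subalgebra.toSubmodule (Algebra.adjoin R {t}) := by
      rw [hb]
      exact hK _ hc _ (Algebra.self_mem_adjoin_singleton R t)
    have hcK : algebraMap R S f.leadingCoeff ∈
        colonIdeal R t • Subalgebra.toSubmodule (Algebra.adjoin R {t}) := by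
      rw [Algebra.algebraMap_eq_smul_one]
      exact hK _ hc _ (one_mem _)
    -- Trading the leading term for b X^d keeps t a root, lowers the degree, and changes
    -- coefficients only by elements of (R : t)R[t].
    have h1 := ih (f.eraseLead + C b * X ^ d) ?_ ?_
    · intro i
      have hi := h1 i
      rw [hf1]
      rw [coeff_add, coeff_C_mul_X_pow, map_add] at hi ⊢
      refine add_mem ((Submodule.add_mem_iff_left _ ?_).1 hi) ?_
      · split_ifs
        · exact hbK
        · simp
      · split_ifs
        · exact hcK
        · simp
    · refine lt_of_le_of_lt (natDegree_add_le _ _) (max_lt ?_ ?_)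
      · have := eraseLead_natDegree_le f; omega
      · have := natDegree_C_mul_X_pow_le b d; omega
    · rw [← h0]
      conv_rhs => rw [hf1]
      simp only [map_add, map_mul, aeval_C, map_pow, aeval_X, hb, Algebra.smul_def, pow_succ]
      ring

theorem HasFCP.isPruferElement (h : HasFCP R S) (hinj : Function.Injective (algebraMap R S))
    {T : Subalgebra R S} (hT : ∀ x ∈ T, IsIntegral R x → x ∈ (⊥ : Subalgebra R S))
    {t : S} (ht : t ∈ T) : IsPruferElement R t := by
  obtain ⟨f, hf, i, hi⟩ := h.exists_aeval_eq_zero R t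
  simpa [hi, IsPruferElement] using
    algebraMap_coeff_mem_colonIdeal_smul_adjoin hinj hT ht _ f (Nat.lt_succ_self _) hf i

/-- The ascending chain condition makes it a finitely generated algebra; being integral, it is then
a finite module. -/
theorem HasFCP.fg_integralClosure (h : HasFCP R S) :
    (Subalgebra.toSubmodule (integralClosure R S)).FG := by
  have := h.wellFoundedGT
  let C : Set (Subalgebra R S) :=
    {X | ∃ s : Set S, s.Finite ∧ s ⊆ integralClosure R S ∧ X = Algebra.adjoin R s}
  obtain ⟨X, ⟨s, hs, hsA, rfl⟩, hmax⟩ :=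
    exists_maximal_of_wellFoundedGT (fun X => X ∈ C) ⟨_, ∅, Set.finite_empty, by simp, rfl⟩
  have hA : integralClosure R S = Algebra.adjoin R s := by
    refine le_antisymm (fun x hx => ?_) (Algebra.adjoin_le hsA)
    exact hmax ⟨insert x s, hs.insert x, Set.insert_subset hx hsA, rfl⟩
      (Algebra.adjoin_mono (Set.subset_insert x s)) (Algebra.subset_adjoin (Set.mem_insert x s))
  rw [hA]
  exact fg_adjoin_of_finite hs hsA

end FiniteChains

/-! ### The Prüfer hull as the elements comaximal to the conductor -/

section Conductor

variable (R S : Type*) [CommRing R] [CommRing S] [Algebra R S]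

/-- The conductor of `R` in its integral closure in `S`. -/
def integralConductor : Ideal R where
  carrier := {r | ∀ a ∈ integralClosure R S, r • a ∈ (⊥ : Subalgebra R S)}
  add_mem' := fun ha hb x hx => by
    rw [add_smul]
    exact add_mem (ha x hx) (hb x hx)
  zero_mem' := fun x _ => by simp
  smul_mem' := fun c r hr x hx => by
    rw [smul_eq_mul, mul_smul]
    exact Subalgebra.smul_mem _ (hr x hx) c

variable {R S}

theorem colonIdeal_mul_le (s t : S) : colonIdeal R s * colonIdeal R t ≤ colonIdeal R (s * t) :=
  Ideal.mul_le.2 fun a ha b hb => by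
    rw [mem_colonIdeal, ← smul_mul_smul_comm]
    exact mul_mem ha hb

theorem colonIdeal_inf_le (s t : S) : colonIdeal R s ⊓ colonIdeal R t ≤ colonIdeal R (s + t) :=
  fun r hr => by
    rw [mem_colonIdeal, smul_add]
    exact add_mem hr.1 hr.2

theorem colonIdeal_of_mem_bot {s : S} (hs : s ∈ (⊥ : Subalgebra R S)) : colonIdeal R s = ⊤ :=
  (Ideal.eq_top_iff_one _).2 (by rwa [mem_colonIdeal, one_smul])

variable (R S) in
/-- The elements `s` of `S` such that `(R : s)` is comaximal to the conductor of `R` in its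
integral closure. -/
def comaximalSubalgebra : Subalgebra R S where
  carrier := {s | colonIdeal R s ⊔ integralConductor R S = ⊤}
  mul_mem' := fun {s t} hs ht =>
    top_unique (((Ideal.mul_sup_eq_of_coprime_left hs).trans ht).ge.trans
      (sup_le_sup_right (colonIdeal_mul_le s t) _))
  add_mem' := fun {s t} hs ht =>
    top_unique (((Ideal.mul_sup_eq_of_coprime_left hs).trans ht).ge.trans
      (sup_le_sup_right (Ideal.mul_le_inf.trans (colonIdeal_inf_le s t)) _))
  algebraMap_mem' := fun r => by
    show _ ⊔ _ = _
    rw [colonIdeal_of_mem_bot (Subalgebra.algebraMap_mem _ r), top_sup_eq]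

theorem mem_comaximalSubalgebra {s : S} :
    s ∈ comaximalSubalgebra R S ↔ colonIdeal R s ⊔ integralConductor R S = ⊤ := Iff.rfl

/-- An integral Prüfer element lies in the base ring. -/
theorem IsPruferElement.mem_bot_of_isIntegral (hinj : Function.Injective (algebraMap R S))
    {s : S} (hs : IsPruferElement R s) (hint : IsIntegral R s) : s ∈ (⊥ : Subalgebra R S) := by
  let B := Algebra.adjoin R {s}
  have hBint : Algebra.IsIntegral R B := by
    rw [← le_integralClosure_iff_isIntegral]
    exact Algebra.adjoin_le (Set.singleton_subset_iff.2 hint)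
  have hinjB : Function.Injective (algebraMap R B) := fun a b hab =>
    hinj (congrArg Subtype.val hab)
  by_contra hne
  have hcolon : colonIdeal R s ≠ ⊤ := fun h => hne (by
    simpa [mem_colonIdeal] using (Ideal.eq_top_iff_one _).1 h)
  obtain ⟨m, hm, hle⟩ := Ideal.exists_le_maximal _ hcolon
  have hker : RingHom.ker (algebraMap R B) ≤ m := by
    rw [(RingHom.injective_iff_ker_eq_bot _).1 hinjB]
    exact bot_le
  -- Lying over: a proper (R : s) extends to a proper ideal of the integral extension R[s].
  obtain ⟨Q, hQ, rfl⟩ := Ideal.exists_ideal_over_maximal_of_isIntegral m hker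
  have h1 := (one_mem_colonIdeal_smul_top_iff (T := B)
    ⟨s, Algebra.self_mem_adjoin_singleton R s⟩).2 hs
  rw [← colonIdeal_coe, Ideal.smul_top_eq_map, Submodule.restrictScalars_mem] at h1
  exact hQ.ne_top ((Ideal.eq_top_iff_one _).2 (Ideal.map_le_iff_le_comap.2 hle h1))

/-- Supplies the finite generation required by Nakayama's lemma when (R : s) is not finitely
generated. -/
theorem exists_fg_le_of_mem_smul {M : Type*} [AddCommGroup M] [Module R M] {I : Ideal R}
    {N : Submodule R M} {x : M} (hx : x ∈ I • N) : ∃ J : Ideal R, J ≤ I ∧ J.FG ∧ x ∈ J • N := by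
  refine Submodule.smul_induction_on hx (fun r hr y hy => ?_) fun x y hx hy => ?_
  · exact ⟨Ideal.span {r}, (Ideal.span_singleton_le_iff_mem _).2 hr, ⟨{r}, by simp⟩,
      Submodule.smul_mem_smul (Ideal.mem_span_singleton_self r) hy⟩
  · obtain ⟨J, hJ, hJfg, hxJ⟩ := hx
    obtain ⟨K, hK, hKfg, hyK⟩ := hy
    exact ⟨J ⊔ K, sup_le hJ hK, Submodule.FG.sup hJfg hKfg,
      add_mem (Submodule.smul_mono le_sup_left le_rfl hxJ)
        (Submodule.smul_mono le_sup_right le_rfl hyK)⟩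

/-- The subalgebra `R + I A`. -/
def baseAddIdeal (A : Subalgebra R S) (I : Ideal R) : Subalgebra R S :=
  Submodule.toSubalgebra (Subalgebra.toSubmodule ⊥ ⊔ I • Subalgebra.toSubmodule A)
    (Submodule.mem_sup_left (one_mem (⊥ : Subalgebra R S))) (by
      intro x y hx hy
      obtain ⟨a, ha, u, hu, rfl⟩ := Submodule.mem_sup.1 hx
      obtain ⟨b, hb, v, hv, rfl⟩ := Submodule.mem_sup.1 hy
      obtain ⟨r, rfl⟩ := Algebra.mem_bot.1 ha
      have hxy : (algebraMap R S r + u) * (b + v) =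
          algebraMap R S r * b + (r • v + u * (b + v)) := by
        rw [Algebra.smul_def]; ring
      rw [hxy]
      refine add_mem (Submodule.mem_sup_left (mul_mem (S := Subalgebra R S) ha hb))
        (Submodule.mem_sup_right (add_mem (Submodule.smul_mem _ r hv) ?_))
      have hbv : b + v ∈ A := add_mem ((bot_le : ⊥ ≤ A) hb) (Submodule.smul_le_right hv)
      refine Submodule.smul_induction_on hu (fun r hr z hz => ?_) fun y z hy hz => ?_
      · rw [smul_mul_assoc]
        exact Submodule.smul_mem_smul hr (mul_mem (S := Subalgebra R S) hz hbv)
      · rw [add_mul]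
        exact add_mem hy hz)

theorem toSubmodule_baseAddIdeal (A : Subalgebra R S) (I : Ideal R) :
    Subalgebra.toSubmodule (baseAddIdeal A I) =
      Subalgebra.toSubmodule ⊥ ⊔ I • Subalgebra.toSubmodule A :=
  Submodule.toSubalgebra_toSubmodule _ _ _

theorem baseAddIdeal_mono (A : Subalgebra R S) {I J : Ideal R} (h : I ≤ J) :
    baseAddIdeal A I ≤ baseAddIdeal A J := by
  rw [← Subalgebra.toSubmodule.le_iff_le, toSubmodule_baseAddIdeal, toSubmodule_baseAddIdeal]
  exact sup_le_sup_left (Submodule.smul_mono h le_rfl) _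

/-- Take J ≤ (R : t) finitely generated with JT = T. The chain R + JⁿA stabilises, so Nakayama
yields r ∈ 1 + J with r JⁿA ⊆ R. As JⁿT = T, this gives rA ⊆ T ∩ A = R, so r is in the conductor. -/
theorem HasFCP.le_comaximalSubalgebra (h : HasFCP R S)
    {T : Subalgebra R S} (hT : ∀ t ∈ T, IsPruferElement R t)
    (hTA : ∀ x ∈ T, x ∈ integralClosure R S → x ∈ (⊥ : Subalgebra R S)) :
    T ≤ comaximalSubalgebra R S := by
  intro t ht
  obtain ⟨J, hJ, hJfg, h1⟩ := exists_fg_le_of_mem_smul ((hT t ht).one_mem_smul ht)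
  have hJpow : ∀ n : ℕ, (1 : S) ∈ J ^ n • Subalgebra.toSubmodule T := by
    have hJT : J • Subalgebra.toSubmodule T = Subalgebra.toSubmodule T := by
      refine le_antisymm Submodule.smul_le_right fun x hx => ?_
      have : ∀ y ∈ J • Subalgebra.toSubmodule T, y * x ∈ J • Subalgebra.toSubmodule T := by
        intro y hy
        refine Submodule.smul_induction_on hy (fun r hr z hz => ?_) fun y z hy hz => ?_
        · rw [smul_mul_assoc]
          exact Submodule.smul_mem_smul hr (mul_mem (S := Subalgebra R S) hz hx)
        · rw [add_mul]
          exact add_mem hy hz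
      simpa using this 1 h1
    intro n
    suffices J ^ n • Subalgebra.toSubmodule T = Subalgebra.toSubmodule T from
      this.symm ▸ one_mem T
    induction n with
    | zero => rw [pow_zero, Ideal.one_eq_top, Submodule.top_smul]
    | succ n ih => rw [pow_succ, Submodule.mul_smul, hJT, ih]
  obtain ⟨n, hn⟩ := h.exists_eq_succ_of_antitone
    (f := fun n => baseAddIdeal (integralClosure R S) (J ^ n))
    fun m n hmn => baseAddIdeal_mono _ (Ideal.pow_le_pow_right hmn)
  have hle : J ^ n • Subalgebra.toSubmodule (integralClosure R S) ≤ Subalgebra.toSubmodule ⊥ ⊔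
      J • J ^ n • Subalgebra.toSubmodule (integralClosure R S) := by
    rw [← Submodule.mul_smul, ← pow_succ', ← toSubmodule_baseAddIdeal, ← hn,
      toSubmodule_baseAddIdeal]
    exact le_sup_right
  obtain ⟨r, hr, hrA⟩ := Submodule.exists_sub_one_mem_and_smul_le_of_fg_of_le_sup
    (Submodule.FG.smul (Ideal.FG.pow hJfg) h.fg_integralClosure) le_rfl hle
  have hrc : r ∈ integralConductor R S := by
    intro a ha
    refine hTA _ ?_ (Subalgebra.smul_mem _ ha r)
    have key : ∀ y ∈ J ^ n • Subalgebra.toSubmodule T, r • (a * y) ∈ T := by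
      intro y hy
      refine Submodule.smul_induction_on hy (fun j hj z hz => ?_) fun y z hy hz => ?_
      · rw [mul_smul_comm, ← smul_mul_assoc, ← smul_mul_assoc]
        have : r • j • a ∈ (⊥ : Subalgebra R S) :=
          hrA (Submodule.smul_mem_pointwise_smul _ _ _ (Submodule.smul_mem_smul hj ha))
        exact mul_mem ((bot_le : ⊥ ≤ T) this) hz
      · rw [mul_add, smul_add]
        exact add_mem hy hz
    simpa using key 1 (hJpow n)
  rw [mem_comaximalSubalgebra, Ideal.eq_top_iff_one, show (1 : R) = -(r - 1) + r by ring]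
  exact add_mem (Ideal.mem_sup_left (neg_mem (hJ hr))) (Ideal.mem_sup_right hrc)

/-- Over A every s is Prüfer, since A is integrally closed in S. Multiplying that relation by
squares from the conductor brings it down to R; comaximality with (R : s) then recovers 1. -/
theorem HasFCP.isPruferElement_of_mem_comaximalSubalgebra (h : HasFCP R S) {s : S}
    (hs : s ∈ comaximalSubalgebra R S) : IsPruferElement R s := by
  let A := integralClosure R S
  have hsA : IsPruferElement A s := (h.subalgebra_base A).isPruferElement (T := ⊤)
    Subtype.val_injective (fun x _ hx => Algebra.mem_bot.2
      ⟨⟨x, isIntegral_trans (R := R) x hx⟩, rfl⟩) trivial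
  have hadj : ∀ r ∈ integralConductor R S, ∀ x ∈ Algebra.adjoin A {s},
      r • x ∈ Algebra.adjoin R {s} := by
    intro r hr x hx
    rw [Algebra.adjoin_singleton_eq_range_aeval] at hx
    obtain ⟨f, rfl⟩ := hx
    induction f using Polynomial.induction_on' with
    | add f g hf hg =>
      simp only [map_add, smul_add]
      exact add_mem hf hg
    | monomial n a =>
      have := (bot_le : ⊥ ≤ Algebra.adjoin R {s}) (hr a a.2)
      rw [AlgHom.toRingHom_eq_coe, RingHom.coe_coe, Polynomial.aeval_monomial, ← smul_mul_assoc]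
      exact mul_mem this (pow_mem (Algebra.self_mem_adjoin_singleton R s) n)
  have hsq : ∀ r ∈ integralConductor R S, ∀ x ∈ colonIdeal A s •
      Subalgebra.toSubmodule (Algebra.adjoin A {s}), (r * r) • x ∈
        colonIdeal R s • Subalgebra.toSubmodule (Algebra.adjoin R {s}) := by
    intro r hr x hx
    refine Submodule.smul_induction_on hx (fun a ha y hy => ?_) fun x y hx hy => ?_
    · obtain ⟨b, hb⟩ := Algebra.mem_bot.1 (hr a a.2)
      obtain ⟨c, hc⟩ := Algebra.mem_bot.1 (mem_colonIdeal.1 ha)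
      have : (r * r) • a • y = b • r • y := by
        rw [Algebra.smul_def b, hb, mul_smul, Algebra.smul_def a]
        simp only [smul_mul_assoc, mul_smul_comm]
        rfl
      rw [this]
      refine Submodule.smul_mem_smul ?_ (hadj r hr y hy)
      rw [mem_colonIdeal, Algebra.smul_def, hb, smul_mul_assoc]
      have hc' : (c : S) = (a : S) * s := hc
      exact hc' ▸ hr c c.2
    · rw [smul_add]
      exact add_mem hx hy
  obtain ⟨x, hx, y, hy, hxy⟩ := Submodule.mem_sup.1 ((Ideal.eq_top_iff_one _).1 hs)
  -- Square x + y = 1 so that the conductor part y appears as y².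
  have : (1 : S) = (x * (x + 2 * y)) • (1 : S) + (y * y) • (1 : S) := by
    rw [← add_smul, show x * (x + 2 * y) + y * y = (x + y) * (x + y) by ring, hxy]
    simp
  rw [IsPruferElement, this]
  exact add_mem (Submodule.smul_mem_smul (Ideal.mul_mem_right _ _ hx)
    (one_mem (Algebra.adjoin R {s})))
    (hsq y hy 1 hsA)

theorem HasFCP.isGreatest_comaximalSubalgebra (h : HasFCP R S)
    (hinj : Function.Injective (algebraMap R S)) :
    IsGreatest {T : Subalgebra R S | IsPruferExtension R T} (comaximalSubalgebra R S) := by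
  constructor
  · exact (isPruferExtension_subalgebra_iff hinj _).2 fun t ht =>
      h.isPruferElement_of_mem_comaximalSubalgebra ht
  · intro T hT
    have hT := (isPruferExtension_subalgebra_iff hinj _).1 hT
    exact h.le_comaximalSubalgebra hT fun x hx hint => (hT x hx).mem_bot_of_isIntegral hinj hint

end Conductor

/-! ### Localization inside S and the dichotomy at the conductor -/

section LocalSaturation

variable {R S : Type*} [CommRing R] [CommRing S] [Algebra R S]

/-- The preimage in `S` of the localization of `Z` at the prime ideal `p` of `R`. -/
def localSaturation (p : PrimeSpectrum R) (Z : Subalgebra R S) : Subalgebra R S where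
  carrier := {s | ∃ r ∉ p.asIdeal, r • s ∈ Z}
  mul_mem' := fun {s t} ⟨a, ha, has⟩ ⟨b, hb, hbt⟩ =>
    ⟨a * b, p.2.mul_notMem ha hb, by rw [← smul_mul_smul_comm]; exact mul_mem has hbt⟩
  add_mem' := fun {s t} ⟨a, ha, has⟩ ⟨b, hb, hbt⟩ =>
    ⟨a * b, p.2.mul_notMem ha hb, by
      rw [smul_add]
      refine add_mem ?_ ?_
      · rw [mul_comm, mul_smul]
        exact Z.smul_mem has b
      · rw [mul_smul]
        exact Z.smul_mem hbt a⟩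
  algebraMap_mem' := fun r =>
    ⟨1, fun h => p.2.ne_top ((Ideal.eq_top_iff_one _).2 h), by
      rw [one_smul]; exact Z.algebraMap_mem r⟩

theorem mem_localSaturation {p : PrimeSpectrum R} {Z : Subalgebra R S} {s : S} :
    s ∈ localSaturation p Z ↔ ∃ r ∉ p.asIdeal, r • s ∈ Z := Iff.rfl

theorem le_localSaturation (p : PrimeSpectrum R) (Z : Subalgebra R S) :
    Z ≤ localSaturation p Z := fun s hs =>
  ⟨1, fun h => p.2.ne_top ((Ideal.eq_top_iff_one _).2 h), by rwa [one_smul]⟩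

theorem localSaturation_mono (p : PrimeSpectrum R) {Y Z : Subalgebra R S} (h : Y ≤ Z) :
    localSaturation p Y ≤ localSaturation p Z := fun _ ⟨r, hr, hs⟩ => ⟨r, hr, h hs⟩

theorem localSaturation_inf (p : PrimeSpectrum R) (Y Z : Subalgebra R S) :
    localSaturation p (Y ⊓ Z) = localSaturation p Y ⊓ localSaturation p Z := by
  refine le_antisymm (le_inf (localSaturation_mono p inf_le_left)
    (localSaturation_mono p inf_le_right)) ?_
  rintro s ⟨⟨a, ha, has⟩, b, hb, hbs⟩
  refine ⟨a * b, p.2.mul_notMem ha hb, ?_, ?_⟩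
  · rw [mul_comm, mul_smul]
    exact Y.smul_mem has b
  · rw [mul_smul]
    exact Z.smul_mem hbs a

theorem le_localSaturation_trans {p : PrimeSpectrum R} {X Y Z : Subalgebra R S}
    (hXY : X ≤ localSaturation p Y) (hYZ : Y ≤ localSaturation p Z) :
    X ≤ localSaturation p Z := by
  intro s hs
  obtain ⟨a, ha, has⟩ := hXY hs
  obtain ⟨b, hb, hbs⟩ := hYZ has
  exact ⟨b * a, p.2.mul_notMem hb ha, by rwa [mul_smul]⟩

/-- The ideal of r with rs ∈ Z lies in no maximal ideal. -/
theorem le_of_forall_le_localSaturation {Y Z : Subalgebra R S}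
    (h : ∀ p : PrimeSpectrum R, Y ≤ localSaturation p Z) : Y ≤ Z := by
  intro s hs
  let I : Ideal R := (Subalgebra.toSubmodule Z).comap (LinearMap.toSpanSingleton R S s)
  have hI : I = ⊤ := by
    by_contra hne
    obtain ⟨m, hm, hle⟩ := Ideal.exists_le_maximal I hne
    obtain ⟨r, hr, hrs⟩ := h ⟨m, hm.isPrime⟩ hs
    exact hr (hle hrs)
  simpa [I] using (Ideal.eq_top_iff_one I).1 hI

theorem exists_forall_smul_mem_of_subset_localSaturation {p : PrimeSpectrum R}
    {Z : Subalgebra R S} (s : Finset S) (hs : (s : Set S) ⊆ localSaturation p Z) :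
    ∃ r ∉ p.asIdeal, ∀ a ∈ s, r • a ∈ Z := by
  have : ∀ a ∈ s, ∃ r ∉ p.asIdeal, r • a ∈ Z := fun a ha => hs ha
  choose! f hf hfa using this
  refine ⟨∏ a ∈ s, f a, Submonoid.prod_mem p.asIdeal.primeCompl hf, fun a ha => ?_⟩
  obtain ⟨c, hc⟩ := Finset.dvd_prod_of_mem f ha
  rw [hc, mul_comm, mul_smul]
  exact Z.smul_mem (hfa a ha) c

theorem mem_suppQuotient {A B : Subalgebra R S} {p : PrimeSpectrum R} :
    p ∈ suppQuotient A B ↔ ¬ B ≤ localSaturation p A := by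
  rw [suppQuotient, Module.mem_support_iff', (Submodule.Quotient.mk_surjective _).exists,
    SetLike.not_le_iff_exists, Subtype.exists]
  have hz (x : S) (hx : x ∈ Subalgebra.toSubmodule B) (r : R) :
      r • (Submodule.Quotient.mk ⟨x, hx⟩ : Subalgebra.toSubmodule B ⧸
        (Subalgebra.toSubmodule A).submoduleOf (Subalgebra.toSubmodule B)) = 0 ↔ r • x ∈ A := by
    rw [← Submodule.Quotient.mk_smul, Submodule.Quotient.mk_eq_zero]
    rfl
  simp only [ne_eq, hz, mem_localSaturation, not_exists, not_and, exists_prop]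
  rfl

theorem HasFCP.pruferHull_eq (h : HasFCP R S) (hinj : Function.Injective (algebraMap R S)) :
    pruferHull R S = comaximalSubalgebra R S :=
  pruferHull_eq_of_isGreatest R S (h.isGreatest_comaximalSubalgebra hinj)

theorem HasFCP.isPruferExtension_pruferHull (h : HasFCP R S)
    (hinj : Function.Injective (algebraMap R S)) : IsPruferExtension R (pruferHull R S) := by
  rw [h.pruferHull_eq hinj]
  exact (h.isGreatest_comaximalSubalgebra hinj).1

theorem le_pruferHull {T : Subalgebra R S} (hT : IsPruferExtension R T) : T ≤ pruferHull R S :=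
  le_sSup hT

theorem integralClosure_le_localSaturation {p : PrimeSpectrum R}
    (hp : ¬ integralConductor R S ≤ p.asIdeal) (Z : Subalgebra R S) :
    integralClosure R S ≤ localSaturation p Z := by
  obtain ⟨r, hr, hrp⟩ := SetLike.not_le_iff_exists.1 hp
  exact fun a ha => ⟨r, hrp, (bot_le : ⊥ ≤ Z) (hr a ha)⟩

theorem HasFCP.pruferHull_le_localSaturation (h : HasFCP R S)
    (hinj : Function.Injective (algebraMap R S)) {p : PrimeSpectrum R}
    (hp : integralConductor R S ≤ p.asIdeal) (Z : Subalgebra R S) :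
    pruferHull R S ≤ localSaturation p Z := by
  rw [h.pruferHull_eq hinj]
  intro s hs
  have : ¬ colonIdeal R s ≤ p.asIdeal := fun hle =>
    p.2.ne_top (top_unique ((mem_comaximalSubalgebra.1 hs).ge.trans (sup_le hle hp)))
  obtain ⟨r, hr, hrp⟩ := SetLike.not_le_iff_exists.1 this
  exact ⟨r, hrp, (bot_le : ⊥ ≤ Z) hr⟩

/-- Since A is a finite module, one denominator outside p serves all generators, so the support of
A/R is the closed set of the conductor. -/
theorem HasFCP.mem_suppQuotient_bot_integralClosure (h : HasFCP R S) {p : PrimeSpectrum R} :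
    p ∈ suppQuotient ⊥ (integralClosure R S) ↔ integralConductor R S ≤ p.asIdeal := by
  refine ⟨fun hp => by_contra fun hc =>
    mem_suppQuotient.1 hp (integralClosure_le_localSaturation hc _), fun hc =>
      mem_suppQuotient.2 fun hle => ?_⟩
  obtain ⟨s, hs⟩ := h.fg_integralClosure
  have hsA : ∀ a ∈ s, a ∈ integralClosure R S := fun a ha =>
    (hs ▸ Submodule.subset_span ha : a ∈ Subalgebra.toSubmodule (integralClosure R S))
  obtain ⟨r, hr, hrs⟩ :=
    exists_forall_smul_mem_of_subset_localSaturation s fun a ha => hle (hsA a ha)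
  refine hr (hc fun x hx => ?_)
  replace hx : x ∈ Submodule.span R (s : Set S) := hs ▸ hx
  have hspan : Submodule.span R (s : Set S) ≤
      (Subalgebra.toSubmodule ⊥).comap (LinearMap.lsmul R S r) := Submodule.span_le.2 hrs
  exact hspan hx

/-- At primes containing the conductor X is absorbed into R; at the others A is. -/
theorem HasFCP.prufer_sup_integral_inf_integralClosure (h : HasFCP R S)
    (hinj : Function.Injective (algebraMap R S)) {X Y : Subalgebra R S}
    (hX : X ≤ pruferHull R S) (hY : Y ≤ integralClosure R S) :
    (X ⊔ Y) ⊓ integralClosure R S = Y := by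
  refine le_antisymm (le_of_forall_le_localSaturation fun p => ?_) (le_inf le_sup_right hY)
  by_cases hp : integralConductor R S ≤ p.asIdeal
  · exact inf_le_left.trans (sup_le (hX.trans (h.pruferHull_le_localSaturation hinj hp Y))
      (le_localSaturation p Y))
  · exact inf_le_right.trans (integralClosure_le_localSaturation hp Y)

theorem HasFCP.prufer_sup_integral_inf_pruferHull (h : HasFCP R S)
    (hinj : Function.Injective (algebraMap R S)) {X Y : Subalgebra R S}
    (hX : X ≤ pruferHull R S) (hY : Y ≤ integralClosure R S) :
    (X ⊔ Y) ⊓ pruferHull R S = X := by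
  refine le_antisymm (le_of_forall_le_localSaturation fun p => ?_) (le_inf le_sup_left hX)
  by_cases hp : integralConductor R S ≤ p.asIdeal
  · exact inf_le_right.trans (h.pruferHull_le_localSaturation hinj hp X)
  · exact inf_le_left.trans (sup_le (le_localSaturation p X)
      (hY.trans (integralClosure_le_localSaturation hp X)))

theorem top_le_localSaturation_pruferHull
    (htop : pruferHull R S ⊔ integralClosure R S = ⊤) {p : PrimeSpectrum R}
    (hp : ¬ integralConductor R S ≤ p.asIdeal) : ⊤ ≤ localSaturation p (pruferHull R S) :=
  htop ▸ sup_le (le_localSaturation p _) (integralClosure_le_localSaturation hp _)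

theorem HasFCP.top_le_localSaturation_integralClosure (h : HasFCP R S)
    (hinj : Function.Injective (algebraMap R S))
    (htop : pruferHull R S ⊔ integralClosure R S = ⊤) {p : PrimeSpectrum R}
    (hp : integralConductor R S ≤ p.asIdeal) : ⊤ ≤ localSaturation p (integralClosure R S) :=
  htop ▸ sup_le (h.pruferHull_le_localSaturation hinj hp _) (le_localSaturation p _)

theorem HasFCP.inf_pruferHull_sup_inf_integralClosure (h : HasFCP R S)
    (hinj : Function.Injective (algebraMap R S))
    (htop : pruferHull R S ⊔ integralClosure R S = ⊤) (T : Subalgebra R S) :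
    (T ⊓ pruferHull R S) ⊔ (T ⊓ integralClosure R S) = T := by
  refine le_antisymm (sup_le inf_le_left inf_le_left)
    (le_of_forall_le_localSaturation fun p => ?_)
  by_cases hp : integralConductor R S ≤ p.asIdeal
  · refine le_trans ?_ (localSaturation_mono p le_sup_right)
    rw [localSaturation_inf]
    exact le_inf (le_localSaturation p T)
      (le_top.trans (h.top_le_localSaturation_integralClosure hinj htop hp))
  · refine le_trans ?_ (localSaturation_mono p le_sup_left)
    rw [localSaturation_inf]
    exact le_inf (le_localSaturation p T) (le_top.trans (top_le_localSaturation_pruferHull htop hp))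

theorem HasFCP.inf_pruferHull_sup_integralClosure (h : HasFCP R S)
    (hinj : Function.Injective (algebraMap R S))
    (htop : pruferHull R S ⊔ integralClosure R S = ⊤) {T : Subalgebra R S}
    (hT : integralClosure R S ≤ T) : (T ⊓ pruferHull R S) ⊔ integralClosure R S = T := by
  conv_rhs => rw [← h.inf_pruferHull_sup_inf_integralClosure hinj htop T]
  rw [inf_eq_right.2 hT]

theorem HasFCP.inf_integralClosure_sup_pruferHull (h : HasFCP R S)
    (hinj : Function.Injective (algebraMap R S))
    (htop : pruferHull R S ⊔ integralClosure R S = ⊤) {T : Subalgebra R S}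
    (hT : pruferHull R S ≤ T) : (T ⊓ integralClosure R S) ⊔ pruferHull R S = T := by
  conv_rhs => rw [← h.inf_pruferHull_sup_inf_integralClosure hinj htop T]
  rw [inf_eq_right.2 hT, sup_comm]

end LocalSaturation

/-! ### Almost-Prüfer extensions and supports -/

section AlmostPrufer

variable {R S : Type*} [CommRing R] [CommRing S] [Algebra R S]

theorem HasFCP.isAlmostPruferExtension_of_sup_eq_top (h : HasFCP R S)
    (hinj : Function.Injective (algebraMap R S))
    (htop : pruferHull R S ⊔ integralClosure R S = ⊤) : IsAlmostPruferExtension R S := by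
  refine ⟨_, h.isPruferExtension_pruferHull hinj, ⟨fun s => ?_⟩⟩
  have hle : pruferHull R S ⊔ integralClosure R S ≤
      (integralClosure (pruferHull R S) S).restrictScalars R :=
    sup_le (fun x hx => isIntegral_algebraMap (x := (⟨x, hx⟩ : pruferHull R S)))
      fun x hx => IsIntegral.tower_top (R := R) hx
  exact hle (htop ▸ Algebra.mem_top)

/-- At p in the support of A/R, the Prüfer part T agrees locally with R, so an integral equation
over T becomes one over R after clearing a denominator. -/
theorem HasFCP.disjoint_support_of_isAlmostPruferExtension (h : HasFCP R S)
    (hinj : Function.Injective (algebraMap R S)) (hap : IsAlmostPruferExtension R S) :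
    suppQuotient ⊥ (integralClosure R S) ∩ suppQuotient (integralClosure R S) ⊤ = ∅ := by
  obtain ⟨T, hT, hint⟩ := hap
  refine Set.eq_empty_of_forall_notMem fun p ⟨hp, hp'⟩ => mem_suppQuotient.1 hp' fun s _ => ?_
  have hpc := h.mem_suppQuotient_bot_integralClosure.1 hp
  have hTp : T ≤ localSaturation p (⊥ : Subalgebra R S) :=
    (le_pruferHull hT).trans (h.pruferHull_le_localSaturation hinj hpc ⊥)
  classical
  obtain ⟨f, hf, hfs⟩ := hint.isIntegral s
  obtain ⟨r, hr, hrf⟩ := exists_forall_smul_mem_of_subset_localSaturation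
    ((f.coeffs).image (Subtype.val : T → S)) (by
      rw [Finset.coe_image, Set.image_subset_iff]
      exact fun a _ => hTp a.2)
  -- Scaling roots by r multiplies the coefficient of degree n by a power of r, positive below the
  -- top degree, which puts it in R, and leaves the polynomial monic with root rs.
  have hlift : f.scaleRoots (algebraMap R T r) ∈ Polynomial.lifts (algebraMap R T) := by
    rw [Polynomial.lifts_iff_coeff_lifts]
    intro n
    rw [Polynomial.coeff_scaleRoots]
    by_cases h0 : f.coeff n = 0
    · exact ⟨0, by rw [h0, zero_mul, map_zero]⟩
    rcases (Polynomial.le_natDegree_of_ne_zero h0).eq_or_lt with hn | hn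
    · exact ⟨1, by rw [hn, Nat.sub_self, pow_zero, mul_one, hf.coeff_natDegree, map_one]⟩
    · obtain ⟨b, hb⟩ := Algebra.mem_bot.1 (hrf _ (Finset.mem_image_of_mem _
        (Polynomial.coeff_mem_coeffs h0)))
      refine ⟨b * r ^ (f.natDegree - n - 1), Subtype.ext ?_⟩
      rw [map_mul, map_pow, ← Nat.sub_add_cancel (Nat.sub_pos_of_lt hn), pow_succ', ← mul_assoc,
        Nat.add_sub_cancel]
      refine congrArg (· * (algebraMap R S r ^ (f.natDegree - n - 1))) ?_
      rw [mul_comm]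
      exact hb.trans (Algebra.smul_def _ _)
  obtain ⟨g, hg, -, hgm⟩ := Polynomial.lifts_and_natDegree_eq_and_monic hlift
    ((Polynomial.monic_scaleRoots_iff _).2 hf)
  refine ⟨r, hr, g, hgm, ?_⟩
  have hroot := Polynomial.scaleRoots_eval₂_eq_zero (s := algebraMap R T r) (algebraMap T S) hfs
  rw [← hg, Polynomial.eval₂_map, ← IsScalarTower.algebraMap_eq,
    ← IsScalarTower.algebraMap_apply, ← Algebra.smul_def] at hroot
  exact hroot

theorem HasFCP.sup_eq_top_of_disjoint_support (h : HasFCP R S)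
    (hinj : Function.Injective (algebraMap R S))
    (hdisj : suppQuotient ⊥ (integralClosure R S) ∩ suppQuotient (integralClosure R S) ⊤ = ∅) :
    pruferHull R S ⊔ integralClosure R S = ⊤ := by
  refine top_unique (le_of_forall_le_localSaturation fun p s _ => ?_)
  by_cases hp : integralConductor R S ≤ p.asIdeal
  · have hp' : p ∉ suppQuotient (integralClosure R S) ⊤ := fun hp' =>
      (Set.eq_empty_iff_forall_notMem.1 hdisj) p
        ⟨h.mem_suppQuotient_bot_integralClosure.2 hp, hp'⟩
    exact localSaturation_mono p le_sup_right
      (not_not.1 (mt mem_suppQuotient.2 hp') (Algebra.mem_top (x := s)))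
  -- For c in the conductor, cs lies in the hull: a maximal m containing (R : cs) and the conductor
  -- is outside Supp(S/A), so rs ∈ A for some r ∉ m, whence r(cs) ∈ R and r ∈ m.
  · obtain ⟨c, hc, hcp⟩ := SetLike.not_le_iff_exists.1 hp
    refine ⟨c, hcp, (le_sup_left : pruferHull R S ≤ _) ?_⟩
    rw [h.pruferHull_eq hinj, mem_comaximalSubalgebra]
    by_contra hne
    obtain ⟨m, hm, hle⟩ := Ideal.exists_le_maximal _ hne
    let q : PrimeSpectrum R := ⟨m, hm.isPrime⟩
    have hq : q ∉ suppQuotient (integralClosure R S) ⊤ := fun hq =>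
      (Set.eq_empty_iff_forall_notMem.1 hdisj) q
        ⟨h.mem_suppQuotient_bot_integralClosure.2 (le_sup_right.trans hle), hq⟩
    obtain ⟨r, hr, hrs⟩ := not_not.1 (mt mem_suppQuotient.2 hq) (Algebra.mem_top (x := s))
    refine hr (hle (Ideal.mem_sup_left ?_))
    rw [mem_colonIdeal, smul_comm]
    exact hc _ hrs

theorem HasFCP.isAlmostPruferExtension_iff (h : HasFCP R S)
    (hinj : Function.Injective (algebraMap R S)) :
    IsAlmostPruferExtension R S ↔ pruferHull R S ⊔ integralClosure R S = ⊤ :=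
  ⟨fun hap => h.sup_eq_top_of_disjoint_support hinj
    (h.disjoint_support_of_isAlmostPruferExtension hinj hap),
    h.isAlmostPruferExtension_of_sup_eq_top hinj⟩

theorem HasFCP.suppQuotient_integralClosure_top (h : HasFCP R S)
    (hinj : Function.Injective (algebraMap R S))
    (htop : pruferHull R S ⊔ integralClosure R S = ⊤) :
    suppQuotient (integralClosure R S) ⊤ = suppQuotient ⊥ (pruferHull R S) := by
  ext p
  rw [mem_suppQuotient, mem_suppQuotient, not_iff_not]
  by_cases hp : integralConductor R S ≤ p.asIdeal
  · exact iff_of_true (h.top_le_localSaturation_integralClosure hinj htop hp)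
      (h.pruferHull_le_localSaturation hinj hp ⊥)
  · have hA := integralClosure_le_localSaturation hp (S := S) ⊥
    exact ⟨fun hle => le_localSaturation_trans (le_top.trans hle) hA, fun hle =>
      le_localSaturation_trans (top_le_localSaturation_pruferHull htop hp)
        (hle.trans (localSaturation_mono p bot_le))⟩

theorem HasFCP.suppQuotient_pruferHull_top (h : HasFCP R S)
    (hinj : Function.Injective (algebraMap R S))
    (htop : pruferHull R S ⊔ integralClosure R S = ⊤) :
    suppQuotient (pruferHull R S) ⊤ = suppQuotient ⊥ (integralClosure R S) := by
  ext p
  rw [mem_suppQuotient, mem_suppQuotient, not_iff_not]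
  by_cases hp : integralConductor R S ≤ p.asIdeal
  · have hP := h.pruferHull_le_localSaturation hinj hp ⊥
    exact ⟨fun hle => le_localSaturation_trans (le_top.trans hle) hP, fun hle =>
      le_localSaturation_trans (h.top_le_localSaturation_integralClosure hinj htop hp)
        (hle.trans (localSaturation_mono p bot_le))⟩
  · exact iff_of_true (top_le_localSaturation_pruferHull htop hp)
      (integralClosure_le_localSaturation hp ⊥)

theorem HasFCP.disjoint_support_of_suppQuotient_eq (h : HasFCP R S)
    (hinj : Function.Injective (algebraMap R S))
    (heq : suppQuotient (integralClosure R S) ⊤ = suppQuotient ⊥ (pruferHull R S)) :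
    suppQuotient ⊥ (integralClosure R S) ∩ suppQuotient (integralClosure R S) ⊤ = ∅ := by
  rw [heq]
  exact Set.eq_empty_of_forall_notMem fun p ⟨hp, hp'⟩ => mem_suppQuotient.1 hp'
    (h.pruferHull_le_localSaturation hinj (h.mem_suppQuotient_bot_integralClosure.1 hp) ⊥)

theorem HasFCP.le_pruferHull_of_inf_integralClosure_le_bot (h : HasFCP R S)
    (hinj : Function.Injective (algebraMap R S)) {T : Subalgebra R S}
    (hT : T ⊓ integralClosure R S ≤ ⊥) : T ≤ pruferHull R S :=
  le_pruferHull ((isPruferExtension_subalgebra_iff hinj T).2 fun _ ht =>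
    h.isPruferElement hinj (fun _ hx hint => hT ⟨hx, hint⟩) ht)

/-- An intermediate ring is determined by its intersection and its product with the
integral closure. -/
theorem HasFCP.le_of_inf_eq_of_sup_eq (h : HasFCP R S) {T U : Subalgebra R S}
    (hinf : T ⊓ integralClosure R S = U ⊓ integralClosure R S)
    (hsup : T ⊔ integralClosure R S = U ⊔ integralClosure R S) : T ≤ U := by
  -- Change base to the common intersection B: over it T and U contain no new integral elements, so
  -- both lie in the Prüfer hull of B, and the modular identity there recovers U from its product
  -- with the integral closure.
  let B := T ⊓ integralClosure R S
  have hBint : ∀ x : S, IsIntegral B x → x ∈ integralClosure R S := by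
    have : Algebra.IsIntegral R B := le_integralClosure_iff_isIntegral.1 inf_le_right
    exact fun x hx => isIntegral_trans (R := R) x hx
  let ext (V : Subalgebra R S) (hV : B ≤ V) : Subalgebra B S :=
    { V.toSubsemiring with algebraMap_mem' := fun b => hV b.2 }
  have hP (V : Subalgebra R S) (hV : B ≤ V) (hVB : V ⊓ integralClosure R S ≤ B) :
      ext V hV ≤ pruferHull B S :=
    (h.subalgebra_base B).le_pruferHull_of_inf_integralClosure_le_bot Subtype.val_injective
      fun x hx => Algebra.mem_bot.2 ⟨⟨x, hVB ⟨hx.1, hBint x hx.2⟩⟩, rfl⟩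
  have hBU : B ≤ U := hinf.le.trans inf_le_left
  have key := (h.subalgebra_base B).prufer_sup_integral_inf_pruferHull Subtype.val_injective
    (hP U hBU hinf.ge) le_rfl
  have hTU : T ≤ (ext U hBU ⊔ integralClosure B S).restrictScalars R :=
    (le_sup_left.trans hsup.le).trans (sup_le
      (fun x hx => (le_sup_left : ext U hBU ≤ _) hx)
      fun x hx => (le_sup_right : integralClosure B S ≤ _) (IsIntegral.tower_top (R := R) hx))
  intro x hx
  have : x ∈ ext U hBU := key ▸ ⟨hTU hx, hP T inf_le_left le_rfl hx⟩
  exact this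

end AlmostPrufer

/-! ### Order embeddings and isomorphisms between the intervals -/

section LatticeMaps

variable {R S : Type*} [CommRing R] [CommRing S] [Algebra R S]

theorem isOrderIsomorphism_of_le_iff_le {α β : Type*} [PartialOrder α] [Preorder β] {f : α → β}
    (hle : ∀ a b, f a ≤ f b ↔ a ≤ b) (hsurj : Function.Surjective f) : IsOrderIsomorphism f :=
  ⟨OrderIso.ofSurjective (OrderEmbedding.ofMapLEIff f hle) hsurj, fun _ => rfl⟩

theorem IsOrderIsomorphism.bijective {α β : Type*} [LE α] [LE β] {f : α → β}
    (hf : IsOrderIsomorphism f) : Function.Bijective f := by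
  obtain ⟨e, he⟩ := hf
  exact (funext he : ⇑e = f) ▸ e.bijective

theorem sup_eq_top_of_surjective_prodMap {A B : Subalgebra R S}
    (h : Function.Surjective (prodMap B A)) : B ⊔ A = ⊤ := by
  obtain ⟨⟨T, hT⟩, hTA⟩ := h ⟨⊤, Set.mem_Ici.2 le_top⟩
  exact top_unique ((congrArg Subtype.val hTA).ge.trans (sup_le_sup_right hT A))

theorem sup_eq_top_of_surjective_prodMap₂ {A B : Subalgebra R S}
    (h : Function.Surjective (prodMap₂ A B)) : A ⊔ B = ⊤ := by
  obtain ⟨⟨⟨X, hX⟩, ⟨Y, hY⟩⟩, hXY⟩ := h ⊤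
  exact top_unique (hXY.ge.trans (sup_le_sup hX hY))

namespace HasFCP

/-- A preimage T of the pair (R, S) has T ∩ A = R, so T lies in the hull, while TA = S. -/
theorem sup_eq_top_of_surjective_infSupMap (h : HasFCP R S)
    (hinj : Function.Injective (algebraMap R S))
    (hsurj : Function.Surjective (infSupMap (integralClosure R S))) :
    pruferHull R S ⊔ integralClosure R S = ⊤ := by
  obtain ⟨T, hT⟩ := hsurj (⟨⊥, Set.mem_Iic.2 bot_le⟩, ⟨⊤, Set.mem_Ici.2 le_top⟩)
  obtain ⟨h1, h2⟩ := Prod.ext_iff.1 hT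
  have hTP := h.le_pruferHull_of_inf_integralClosure_le_bot hinj (congrArg Subtype.val h1).le
  exact top_unique ((congrArg Subtype.val h2).ge.trans (sup_le_sup_right hTP _))

theorem infSupMap_injective (h : HasFCP R S) :
    Function.Injective (infSupMap (integralClosure R S)) := by
  intro T U hTU
  obtain ⟨h1, h2⟩ := Prod.ext_iff.1 hTU
  have hinf := congrArg Subtype.val h1
  have hsup := congrArg Subtype.val h2
  exact le_antisymm (h.le_of_inf_eq_of_sup_eq hinf hsup)
    (h.le_of_inf_eq_of_sup_eq hinf.symm hsup.symm)

theorem prodMap_pruferHull_le_iff (h : HasFCP R S)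
    (hinj : Function.Injective (algebraMap R S)) (X Y : Set.Iic (pruferHull R S)) :
    prodMap (pruferHull R S) (integralClosure R S) X ≤ prodMap _ _ Y ↔ X ≤ Y := by
  refine ⟨fun hle => ?_, fun hle => sup_le_sup_right (α := Subalgebra R S) hle _⟩
  have := inf_le_inf_right (pruferHull R S)
    (show (X : Subalgebra R S) ⊔ integralClosure R S ≤
      (Y : Subalgebra R S) ⊔ integralClosure R S from hle)
  rwa [h.prufer_sup_integral_inf_pruferHull hinj X.2 le_rfl,
    h.prufer_sup_integral_inf_pruferHull hinj Y.2 le_rfl] at this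

theorem prodMap_integralClosure_le_iff (h : HasFCP R S)
    (hinj : Function.Injective (algebraMap R S)) (X Y : Set.Iic (integralClosure R S)) :
    prodMap (integralClosure R S) (pruferHull R S) X ≤ prodMap _ _ Y ↔ X ≤ Y := by
  refine ⟨fun hle => ?_, fun hle => sup_le_sup_right (α := Subalgebra R S) hle _⟩
  have := inf_le_inf_right (integralClosure R S)
    (show (X : Subalgebra R S) ⊔ pruferHull R S ≤ (Y : Subalgebra R S) ⊔ pruferHull R S from hle)
  rwa [sup_comm, sup_comm (Y : Subalgebra R S),
    h.prufer_sup_integral_inf_integralClosure hinj le_rfl X.2,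
    h.prufer_sup_integral_inf_integralClosure hinj le_rfl Y.2] at this

theorem prodMap₂_le_iff (h : HasFCP R S)
    (hinj : Function.Injective (algebraMap R S))
    (x y : Set.Iic (pruferHull R S) × Set.Iic (integralClosure R S)) :
    prodMap₂ (pruferHull R S) (integralClosure R S) x ≤ prodMap₂ _ _ y ↔ x ≤ y := by
  refine ⟨fun hle => ⟨?_, ?_⟩, fun hle => sup_le_sup (α := Subalgebra R S) hle.1 hle.2⟩
  · have := inf_le_inf_right (pruferHull R S) hle
    rwa [prodMap₂, prodMap₂, h.prufer_sup_integral_inf_pruferHull hinj x.1.2 x.2.2,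
      h.prufer_sup_integral_inf_pruferHull hinj y.1.2 y.2.2] at this
  · have := inf_le_inf_right (integralClosure R S) hle
    rwa [prodMap₂, prodMap₂, h.prufer_sup_integral_inf_integralClosure hinj x.1.2 x.2.2,
      h.prufer_sup_integral_inf_integralClosure hinj y.1.2 y.2.2] at this

theorem isOrderIsomorphism_prodMap_pruferHull (h : HasFCP R S)
    (hinj : Function.Injective (algebraMap R S))
    (htop : pruferHull R S ⊔ integralClosure R S = ⊤) :
    IsOrderIsomorphism (prodMap (pruferHull R S) (integralClosure R S)) :=
  isOrderIsomorphism_of_le_iff_le (h.prodMap_pruferHull_le_iff hinj) fun U =>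
    ⟨⟨U ⊓ pruferHull R S, Set.mem_Iic.2 inf_le_right⟩,
      Subtype.ext (h.inf_pruferHull_sup_integralClosure hinj htop U.2)⟩

theorem isOrderIsomorphism_prodMap_integralClosure (h : HasFCP R S)
    (hinj : Function.Injective (algebraMap R S))
    (htop : pruferHull R S ⊔ integralClosure R S = ⊤) :
    IsOrderIsomorphism (prodMap (integralClosure R S) (pruferHull R S)) :=
  isOrderIsomorphism_of_le_iff_le (h.prodMap_integralClosure_le_iff hinj) fun U =>
    ⟨⟨U ⊓ integralClosure R S, Set.mem_Iic.2 inf_le_right⟩,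
      Subtype.ext (h.inf_integralClosure_sup_pruferHull hinj htop U.2)⟩

theorem isOrderIsomorphism_prodMap₂ (h : HasFCP R S)
    (hinj : Function.Injective (algebraMap R S))
    (htop : pruferHull R S ⊔ integralClosure R S = ⊤) :
    IsOrderIsomorphism (prodMap₂ (pruferHull R S) (integralClosure R S)) :=
  isOrderIsomorphism_of_le_iff_le (h.prodMap₂_le_iff hinj) fun T =>
    ⟨(⟨T ⊓ pruferHull R S, Set.mem_Iic.2 inf_le_right⟩,
      ⟨T ⊓ integralClosure R S, Set.mem_Iic.2 inf_le_right⟩),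
      h.inf_pruferHull_sup_inf_integralClosure hinj htop T⟩

theorem isOrderIsomorphism_infSupMap (h : HasFCP R S)
    (hinj : Function.Injective (algebraMap R S))
    (htop : pruferHull R S ⊔ integralClosure R S = ⊤) :
    IsOrderIsomorphism (infSupMap (integralClosure R S)) := by
  refine isOrderIsomorphism_of_le_iff_le (fun T U => ⟨fun hle => ?_, fun hle =>
    ⟨inf_le_inf_right (α := Subalgebra R S) _ hle, sup_le_sup_right (α := Subalgebra R S) hle _⟩⟩)
    fun ⟨⟨Y, hY⟩, ⟨U, hU⟩⟩ => ⟨(U ⊓ pruferHull R S) ⊔ Y, ?_⟩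
  · have h1 : T ⊓ integralClosure R S ≤ U ⊓ integralClosure R S := hle.1
    have h2 : T ⊔ integralClosure R S ≤ U ⊔ integralClosure R S := hle.2
    -- Passing to UA does not change the Prüfer component of U, so the two components of T can be
    -- compared with U separately.
    have hUA : (U ⊔ integralClosure R S) ⊓ pruferHull R S = U ⊓ pruferHull R S := by
      conv_lhs => rw [← h.inf_pruferHull_sup_inf_integralClosure hinj htop U, sup_assoc,
        sup_eq_right.2 (inf_le_right : U ⊓ integralClosure R S ≤ _)]
      exact h.prufer_sup_integral_inf_pruferHull hinj inf_le_right le_rfl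
    rw [← h.inf_pruferHull_sup_inf_integralClosure hinj htop T]
    exact sup_le ((inf_le_inf_right _ (le_sup_left.trans h2)).trans (hUA.le.trans inf_le_left))
      (h1.trans inf_le_left)
  · refine Prod.ext (Subtype.ext ?_) (Subtype.ext ?_)
    · exact h.prufer_sup_integral_inf_integralClosure hinj inf_le_right hY
    · show (U ⊓ pruferHull R S) ⊔ Y ⊔ integralClosure R S = U
      rw [sup_assoc, sup_eq_right.2 (Set.mem_Iic.1 hY)]
      exact h.inf_pruferHull_sup_integralClosure hinj htop hU

end HasFCP

end LatticeMaps

/-! ### The equivalences, with PA = S as the hub -/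

theorem theorem7p6 {R S : Type*} [CommRing R] [CommRing S] [Algebra R S]
    (hinj : Function.Injective (algebraMap R S)) (hFCP : HasFCP R S) :
    List.TFAE
      [suppQuotient ⊥ (integralClosure R S) ∩ suppQuotient (integralClosure R S) ⊤ = ∅,
        IsOrderIsomorphism (infSupMap (integralClosure R S)),
        IsAlmostPruferExtension R S,
        suppQuotient (integralClosure R S) ⊤ = suppQuotient ⊥ (pruferHull R S),
        IsOrderIsomorphism (prodMap (pruferHull R S) (integralClosure R S)),
        IsOrderIsomorphism (prodMap (integralClosure R S) (pruferHull R S)),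
        IsOrderIsomorphism (prodMap₂ (pruferHull R S) (integralClosure R S))] ∧
    (IsAlmostPruferExtension R S →
      suppQuotient (pruferHull R S) ⊤ = suppQuotient ⊥ (integralClosure R S)) ∧
    (HasFIP R S →
      List.TFAE
        [IsAlmostPruferExtension R S,
          Nat.card (Subalgebra R S) =
            Nat.card (Set.Iic (pruferHull R S)) * Nat.card (Set.Iic (integralClosure R S)),
          Nat.card (Subalgebra R S) =
            Nat.card (Set.Iic (integralClosure R S)) * Nat.card (Set.Ici (integralClosure R S)),
          Nat.card (Set.Iic (pruferHull R S)) = Nat.card (Set.Ici (integralClosure R S)),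
          Nat.card (Set.Iic (integralClosure R S)) = Nat.card (Set.Ici (pruferHull R S))]) := by
  have hiff := hFCP.isAlmostPruferExtension_iff hinj
  refine ⟨?_, fun hap => hFCP.suppQuotient_pruferHull_top hinj (hiff.1 hap), fun hFIP => ?_⟩
  · rw [hiff]
    tfae_have 1 → 3 := hFCP.sup_eq_top_of_disjoint_support hinj
    tfae_have 2 → 3 := fun hiso =>
      hFCP.sup_eq_top_of_surjective_infSupMap hinj hiso.bijective.surjective
    tfae_have 5 → 3 := fun hiso => sup_eq_top_of_surjective_prodMap hiso.bijective.surjective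
    tfae_have 6 → 3 := fun hiso =>
      (sup_comm _ _).trans (sup_eq_top_of_surjective_prodMap hiso.bijective.surjective)
    tfae_have 7 → 3 := fun hiso => sup_eq_top_of_surjective_prodMap₂ hiso.bijective.surjective
    tfae_have 4 → 1 := hFCP.disjoint_support_of_suppQuotient_eq hinj
    tfae_have 3 → 2 := hFCP.isOrderIsomorphism_infSupMap hinj
    tfae_have 3 → 4 := hFCP.suppQuotient_integralClosure_top hinj
    tfae_have 3 → 5 := hFCP.isOrderIsomorphism_prodMap_pruferHull hinj
    tfae_have 3 → 6 := hFCP.isOrderIsomorphism_prodMap_integralClosure hinj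
    tfae_have 3 → 7 := hFCP.isOrderIsomorphism_prodMap₂ hinj
    tfae_finish
  · have : Finite (Subalgebra R S) := hFIP
    rw [hiff]
    tfae_have 1 → 2 := fun htop => by
      rw [← Nat.card_prod]
      exact (Nat.card_eq_of_bijective _ (hFCP.isOrderIsomorphism_prodMap₂ hinj htop).bijective).symm
    tfae_have 1 → 3 := fun htop => by
      rw [← Nat.card_prod]
      exact Nat.card_eq_of_bijective _ (hFCP.isOrderIsomorphism_infSupMap hinj htop).bijective
    tfae_have 1 → 4 := fun htop =>
      Nat.card_eq_of_bijective _ (hFCP.isOrderIsomorphism_prodMap_pruferHull hinj htop).bijective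
    tfae_have 1 → 5 := fun htop => Nat.card_eq_of_bijective _
      (hFCP.isOrderIsomorphism_prodMap_integralClosure hinj htop).bijective
    tfae_have 2 → 1 := fun hcard => by
      rw [← Nat.card_prod] at hcard
      exact sup_eq_top_of_surjective_prodMap₂
        ((Nat.bijective_iff_injective_and_card _).2 ⟨fun x y hxy => le_antisymm
          ((hFCP.prodMap₂_le_iff hinj x y).1 hxy.le) ((hFCP.prodMap₂_le_iff hinj y x).1 hxy.ge),
          hcard.symm⟩).surjective
    tfae_have 3 → 1 := fun hcard => by
      rw [← Nat.card_prod] at hcard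
      exact hFCP.sup_eq_top_of_surjective_infSupMap hinj
        ((Nat.bijective_iff_injective_and_card _).2 ⟨hFCP.infSupMap_injective, hcard⟩).surjective
    tfae_have 4 → 1 := fun hcard => sup_eq_top_of_surjective_prodMap
      ((Nat.bijective_iff_injective_and_card _).2 ⟨fun x y hxy => le_antisymm
        ((hFCP.prodMap_pruferHull_le_iff hinj x y).1 hxy.le)
        ((hFCP.prodMap_pruferHull_le_iff hinj y x).1 hxy.ge), hcard⟩).surjective
    tfae_have 5 → 1 := fun hcard => (sup_comm _ _).trans <| sup_eq_top_of_surjective_prodMap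
      ((Nat.bijective_iff_injective_and_card _).2 ⟨fun x y hxy => le_antisymm
        ((hFCP.prodMap_integralClosure_le_iff hinj x y).1 hxy.le)
        ((hFCP.prodMap_integralClosure_le_iff hinj y x).1 hxy.ge), hcard⟩).surjective
    tfae_finish
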